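/- A category is \emph{left exact} if it has all finite limits. For $n,k>0$ and $m\ge 0$ let $\mathsf{matr}(n,m,k)$ be the set of $n\times m$ matrices with entries in $\{0,\dots,k-1\}$. An internal $n$-ary relation on an object $C$ of a category $\mathbb{C}$ is a jointly monic family $r_1,\dots,r_n\colon R\to C$. The category $\mathbb{C}$ \emph{has $N$-closed relations}, for $N=(a_{ij})\in\mathsf{matr}(n,m,k)$, if for every such relation, every object $X$ and every function $f\colon\{0,\dots,k-1\}\to\mathbb{C}(X,C)$ the following holds: if for each $j$ there is $u_j\colon X\to R$ with $f(a_{ij})=r_iu_j$ for all $i$, then there is $v\colon X\to R$ with $f(0)=r_iv$ for all $i$. (For a single relation and a single object $X$, this condition for all $f$ is called being $N$-closed over $X$.) Let $\mathsf{mclex}\{N\}$ be the collection of left exact categories with $N$-closed relations. Consider the matrices $$M=\begin{bmatrix}0&1&1\\1&1&0\end{bmatrix},\quad A=\begin{bmatrix}0&1&1\\1&1&0\\0&1&0\end{bmatrix},\quad A'=\begin{bmatrix}0&0&0&1\\0&0&1&0\\0&1&1&1\\1&0&1&1\end{bmatrix},$$ and let $D_n\in\mathsf{matr}(n,n,2)$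 have ones on the main diagonal and zeros elsewhere ($M$ determines Mal'tsev categories, $D_3$ majority categories, $A$ arithmetical categories). An $n$-ary relation $R\subseteq X^n$ on a set $X$ is \emph{$M$-sharp} if for every $M'=(a'_{ij})\in\mathsf{matr}(n,3,2)$ each of whose rows is a row of $M$, and for all functions $f_1,\dots,f_n\colon\{0,1\}\to X$: if $(f_1(a'_{1j}),\dots,f_n(a'_{nj}))\in R$ for each $j$, then $(f_1(0),\dots,f_n(0))\in R$. Let $\mathbf{Rel}_3$ be the category of sets equipped with a ternary relation, with relation-preserving functions as morphisms, and let $\mathsf{Inj}_{\{M\}}\mathbf{Rel}_3$ be its full subcategory of those objects $X$ such that every internal binary relation on any object of $\mathbf{Rel}_3^{\mathsf{op}}$ is $M$-closed over $X$. Then: 1. $\mathsf{mclex}\{M\}\cap\mathsf{mclex}\{D_3\}=\mathsf{mclex}\{A\}\subsetneq\mathsf{mclex}\{M\}\cap\mathsf{mclex}\{D_4\}$. 2. $\mathsf{mclex}\{A'\}=\mathsf{mclex}\{M\}\cap\mathsf{mclex}\{D_4\}$. 3. The objects of $\mathsf{Inj}_{\{M\}}\mathbf{Rel}_3$ are exactly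 the sets equipped with an $M$-sharp ternary relation. The category $(\mathsf{Inj}_{\{M\}}\mathbf{Rel}_3)^{\mathsf{op}}$ belongs to $\mathsf{mclex}\{M\}\cap\mathsf{mclex}\{D_4\}$, but neither to $\mathsf{mclex}\{D_3\}$ nor to $\mathsf{mclex}\{A\}$. 4. In contrast, for every $n>2$, a regular category belongs to $\mathsf{mclex}\{M\}\cap\mathsf{mclex}\{D_n\}$ if and only if it belongs to $\mathsf{mclex}\{A\}$. Hence the implication from the conjunction of the $M$- and $D_4$-properties to the $A$-property holds for all regular categories but fails for left exact categories. -/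

import Mathlib

open CategoryTheory CategoryTheory.Limits

universe w v u

namespace MatrixClass

/-- An integer matrix: an element of `matr(n, m, k)` for some `n, k > 0` and `m ≥ 0`, that is, an
`n × m` matrix with entries in `{0, …, k - 1}`. -/
structure IntMatrix : Type where
  n : ℕ
  m : ℕ
  k : ℕ
  [n_pos : NeZero n]
  [k_pos : NeZero k]
  entry : Matrix (Fin n) (Fin m) (Fin k)

attribute [instance] IntMatrix.n_pos IntMatrix.k_pos

section Internal

variable {C : Type u} [Category.{v} C]

/-- An internal `n`-ary relation between the objects `X 0, …, X (n - 1)` of a category: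
an object together with a jointly monic family of morphisms from it. -/
structure InternalRel {n : ℕ} (X : Fin n → C) where
  obj : C
  proj : ∀ i, obj ⟶ X i
  jointly_monic : ∀ ⦃Y : C⦄ (x y : Y ⟶ obj), (∀ i, x ≫ proj i = y ≫ proj i) → x = y

/-- The relation `r` is compatible with the row-wise interpretation of `M` given by the functions
`f i : {0, …, k - 1} → C(Y, X i)`: if every left column factors through `r`, then so does the
right column `(f i 0)_i`. -/
def InternalRel.Compatible {n m k : ℕ} [NeZero k] {X : Fin n → C} (r : InternalRel X)
    (M : Matrix (Fin n) (Fin m) (Fin k)) {Y : C} (f : ∀ i, Fin k → (Y ⟶ X i)) : Prop :=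
  (∀ j, ∃ u : Y ⟶ r.obj, ∀ i, f i (M i j) = u ≫ r.proj i) →
    ∃ v : Y ⟶ r.obj, ∀ i, f i 0 = v ≫ r.proj i

/-- An internal relation on a single object `X` is `M`-closed over `Y` when it is compatible with
all ordinary interpretations of `M` of type `C(Y, X)`
(the same function is applied in every row). -/
def InternalRel.ClosedOver {n m k : ℕ} [NeZero k] {X : C} (r : InternalRel (fun _ : Fin n => X))
    (M : Matrix (Fin n) (Fin m) (Fin k)) (Y : C) : Prop :=
  ∀ f : Fin k → (Y ⟶ X), r.Compatible M (fun _ => f)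

variable (C) in
/-- The category `C` has `M`-closed relations. -/
def HasClosedRelations (M : IntMatrix) : Prop :=
  ∀ (X : C) (r : InternalRel (fun _ : Fin M.n => X)) (Y : C), r.ClosedOver M.entry Y

/-- `X` is an `S`-injective object of `C`: for every `M ∈ S`, every internal relation (of the
relevant arity) on any object of `Cᵒᵖ` is `M`-closed over `X`. -/
def IsInjective (S : Set IntMatrix) (X : C) : Prop :=
  ∀ M ∈ S, ∀ (Z : Cᵒᵖ) (r : InternalRel (fun _ : Fin M.n => Z)),
    r.ClosedOver M.entry (Opposite.op X)

variable (C) in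
/-- The full subcategory `Inj_S C` of `S`-injective objects of `C`. -/
abbrev Inj (S : Set IntMatrix) : Type u :=
  ObjectProperty.FullSubcategory (fun X : C => IsInjective S X)

/-- `mclex S`: the left exact (that is, finitely complete) categories having `M`-closed relations
for all `M ∈ S`. -/
def mclex (S : Set IntMatrix) : Set Cat.{v, u} :=
  {C | HasFiniteLimits C ∧ ∀ M ∈ S, HasClosedRelations C M}

end Internal

section Ordinary

/-- An ordinary relation on a set is strictly `M`-closed: it is closed under all row-wise
interpretations of `M`. -/
def StrictlyClosed {n m k : ℕ} [NeZero k] {X : Type w} (R : Set (Fin n → X))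
    (M : Matrix (Fin n) (Fin m) (Fin k)) : Prop :=
  ∀ f : Fin n → Fin k → X, (∀ j, (fun i => f i (M i j)) ∈ R) → (fun i => f i 0) ∈ R

/-- An `n`-ary relation on a set is `M`-sharp: it is strictly `M'`-closed for all matrices `M'`
with `n` rows each of which is a row of `M`. -/
def IsSharp {n : ℕ} {X : Type w} (R : Set (Fin n → X)) (M : IntMatrix) : Prop :=
  ∀ M' : Matrix (Fin n) (Fin M.m) (Fin M.k), (∀ i, ∃ i', M' i = M.entry i') → StrictlyClosed R M'

/-- A set equipped with an `n`-ary relation: an object of the category `Rel_n`. -/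
structure RelCat (n : ℕ) : Type (w + 1) where
  carrier : Type w
  rel : Set (Fin n → carrier)

/-- Morphisms of `Rel_n`: relation-preserving functions. -/
@[ext]
structure RelCat.Hom {n : ℕ} (X Y : RelCat.{w} n) : Type w where
  toFun : X.carrier → Y.carrier
  map_rel : ∀ x ∈ X.rel, (fun i => toFun (x i)) ∈ Y.rel

instance RelCat.category (n : ℕ) : Category.{w} (RelCat.{w} n) where
  Hom X Y := RelCat.Hom X Y
  id X := ⟨fun x => x, fun _ hx => hx⟩
  comp f g := ⟨fun x => g.toFun (f.toFun x), fun x hx => g.map_rel _ (f.map_rel x hx)⟩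

end Ordinary

/-- The Mal'tsev matrix `M`. -/
def maltsev : IntMatrix where
  n := 2
  m := 3
  k := 2
  entry := !![0, 1, 1; 1, 1, 0]

/-- The arithmetical matrix `A`. -/
def arith : IntMatrix where
  n := 3
  m := 3
  k := 2
  entry := !![0, 1, 1; 1, 1, 0; 0, 1, 0]

/-- The matrix `D_n ∈ matr(n, n, 2)`: ones on the main diagonal, zeros elsewhere.
`D 3` is the majority matrix. -/
def D (n : ℕ) [NeZero n] : IntMatrix where
  n := n
  m := n
  k := 2
  entry := fun i j => if i = j then 1 else 0

/-- The matrix `A'`. -/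
def arith' : IntMatrix where
  n := 4
  m := 4
  k := 2
  entry := !![0, 0, 0, 1; 0, 0, 1, 0; 0, 1, 1, 1; 1, 0, 1, 1]

end MatrixClass

/-! In a left exact category a matrix property amounts to a rule on generalized elements of
relations between possibly different objects: if in each coordinate the given elements and the
target follow the pattern of some row, the target belongs to the relation
(`HasClosedRelations.mem`). The equalities and inclusions of classes are then short derivations of
one rule from others.

For the separation, Mal'tsev-injectivity in `Rel_3` is sharpness. In the dual of the injective
objects, a `D 4` problem is trivial: a triple meets only three of the four rows, so some column is
zero at every place. `D 3` lacks this slack, and the triples with exactly one `true` form a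
Mal'tsev-sharp relation violating it.

In a regular category `D n` also acts on images, hence locally on existentially quantified elements.
Applied to zigzags inside a ternary relation, it yields one that Mal'tsev moves collapse to the
arithmetical conclusion (`arith_of_maltsev_of_D`). -/

namespace MatrixClass

/-! ### Matrix properties as rules on generalized elements -/

section Membership

variable {C : Type u} [Category.{v} C]

/-- The family `x` of generalized elements belongs to the internal relation `r`. -/
def InternalRel.Mem {n : ℕ} {X : Fin n → C} (r : InternalRel X) {Y : C} (x : ∀ i, Y ⟶ X i) :
    Prop :=
  ∃ u : Y ⟶ r.obj, ∀ i, x i = u ≫ r.proj i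

/-- A category with `M`-closed relations is compatible with all row-wise interpretations of all
matrices whose rows are rows of `M`, in relations between possibly different objects. -/
theorem HasClosedRelations.compatible [HasFiniteLimits C] {M : IntMatrix}
    (hM : HasClosedRelations C M) {p : ℕ} {X : Fin p → C} (r : InternalRel X)
    (g : Fin p → Fin M.n) {Y : C} (f : ∀ i, Fin M.k → (Y ⟶ X i)) :
    r.Compatible (fun i => M.entry (g i)) f := by
  let Z : C := ∏ᶜ X
  -- Pulling `r` back along `φ` gives a relation on the single object `Z` that reads coordinate `i`
  -- of `r` from its component `g i`; repeated or missing rows do no harm.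
  let φ : (∏ᶜ fun _ : Fin M.n => Z) ⟶ ∏ᶜ X := Pi.lift fun i => Pi.π _ (g i) ≫ Pi.π X i
  let ρ : r.obj ⟶ ∏ᶜ X := Pi.lift r.proj
  let s : InternalRel (fun _ : Fin M.n => Z) :=
    { obj := pullback φ ρ
      proj := fun i => pullback.fst φ ρ ≫ Pi.π _ i
      jointly_monic := fun Y x y h => by
        have h1 : x ≫ pullback.fst φ ρ = y ≫ pullback.fst φ ρ := by
          refine Pi.hom_ext _ _ fun i => ?_
          simpa using h i
        apply pullback.hom_ext h1
        apply r.jointly_monic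
        intro i
        have h2 : pullback.snd φ ρ ≫ r.proj i = pullback.fst φ ρ ≫ φ ≫ Pi.π X i := by
          rw [pullback.condition_assoc]
          simp [ρ]
        rw [Category.assoc, Category.assoc, h2, reassoc_of% h1] }
  have hs : ∀ {Y : C} (z : Fin M.n → (Y ⟶ Z)),
      s.Mem z ↔ r.Mem fun i => z (g i) ≫ Pi.π X i := by
    intro Y z
    constructor
    · rintro ⟨u, hu⟩
      refine ⟨u ≫ pullback.snd φ ρ, fun i => ?_⟩
      have h2 : pullback.snd φ ρ ≫ r.proj i = pullback.fst φ ρ ≫ φ ≫ Pi.π X i := by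
        rw [pullback.condition_assoc]
        simp [ρ]
      simp [s, φ, h2, hu]
    · rintro ⟨u, hu⟩
      have hzu : Pi.lift z ≫ φ = u ≫ ρ := Pi.hom_ext _ _ fun i => by simp [φ, ρ, ← hu]
      have hz : ∀ i, z i = pullback.lift (Pi.lift z) u hzu ≫ pullback.fst φ ρ ≫ Pi.π _ i :=
        fun i => ((pullback.lift_fst_assoc ..).trans (Pi.lift_π ..)).symm
      exact ⟨_, hz⟩
  intro hr
  have key := hM Z s Y (fun a => Pi.lift fun i => f i a) (fun j => (hs _).2 ?_)
  · obtain ⟨u, hu⟩ := (hs _).1 key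
    exact ⟨u, fun i => by rw [← hu]; simp⟩
  · obtain ⟨u, hu⟩ := hr j
    exact ⟨u, fun i => by rw [← hu]; simp⟩

theorem HasClosedRelations.mem [HasFiniteLimits C] {M : IntMatrix}
    (hM : HasClosedRelations C M) {p : ℕ} {X : Fin p → C} {r : InternalRel X} {Y : C}
    {t : Fin M.m → ∀ i, Y ⟶ X i} {w : ∀ i, Y ⟶ X i} (ht : ∀ j, r.Mem (t j))
    (h : ∀ i, ∃ (a : Fin M.n) (f : Fin M.k → (Y ⟶ X i)),
      f 0 = w i ∧ ∀ j, t j i = f (M.entry a j)) : r.Mem w := by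
  choose g f hw hf using h
  obtain rfl : (fun i => f i 0) = w := funext hw
  refine hM.compatible r g f fun j => ?_
  obtain ⟨u, hu⟩ := ht j
  exact ⟨u, fun i => (hf i j).symm.trans (hu i)⟩

variable [HasFiniteLimits C] {p : ℕ} {X : Fin p → C} {r : InternalRel X} {Y : C}

theorem mem_of_maltsev (hM : HasClosedRelations C maltsev) {x y z w : ∀ i, Y ⟶ X i}
    (hx : r.Mem x) (hy : r.Mem y) (hz : r.Mem z)
    (h : ∀ i, (x i = w i ∧ y i = z i) ∨ (x i = y i ∧ z i = w i)) : r.Mem w := by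
  refine hM.mem (t := ![x, y, z]) ?_ fun i => ?_
  · change ∀ j : Fin 3, _
    simp [Fin.forall_fin_succ, hx, hy, hz]
  · rcases h i with ⟨h1, h2⟩ | ⟨h1, h2⟩
    · refine ⟨(0 : Fin 2), ![w i, z i], rfl, ?_⟩
      change ∀ j : Fin 3, _
      simp [Fin.forall_fin_succ, maltsev, h1, h2]
    · refine ⟨(1 : Fin 2), ![w i, y i], rfl, ?_⟩
      change ∀ j : Fin 3, _
      simp [Fin.forall_fin_succ, maltsev, h1, h2]

theorem mem_of_arith (hM : HasClosedRelations C arith) {x y z w : ∀ i, Y ⟶ X i}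
    (hx : r.Mem x) (hy : r.Mem y) (hz : r.Mem z)
    (h : ∀ i, (x i = w i ∧ y i = z i) ∨ (x i = y i ∧ z i = w i) ∨ (x i = w i ∧ z i = w i)) :
    r.Mem w := by
  refine hM.mem (t := ![x, y, z]) ?_ fun i => ?_
  · change ∀ j : Fin 3, _
    simp [Fin.forall_fin_succ, hx, hy, hz]
  · rcases h i with ⟨h1, h2⟩ | ⟨h1, h2⟩ | ⟨h1, h2⟩
    · refine ⟨(0 : Fin 3), ![w i, z i], rfl, ?_⟩
      change ∀ j : Fin 3, _
      simp [Fin.forall_fin_succ, arith, h1, h2]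
    · refine ⟨(1 : Fin 3), ![w i, y i], rfl, ?_⟩
      change ∀ j : Fin 3, _
      simp [Fin.forall_fin_succ, arith, h1, h2]
    · refine ⟨(2 : Fin 3), ![w i, y i], rfl, ?_⟩
      change ∀ j : Fin 3, _
      simp [Fin.forall_fin_succ, arith, h1, h2]

theorem mem_of_arith' (hM : HasClosedRelations C arith') {x y z t w : ∀ i, Y ⟶ X i}
    (hx : r.Mem x) (hy : r.Mem y) (hz : r.Mem z) (ht : r.Mem t)
    (h : ∀ i, (x i = w i ∧ y i = w i ∧ z i = w i) ∨ (x i = w i ∧ y i = w i ∧ t i = w i) ∨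
      (x i = w i ∧ y i = z i ∧ z i = t i) ∨ (y i = w i ∧ x i = z i ∧ z i = t i)) :
    r.Mem w := by
  refine hM.mem (t := ![x, y, z, t]) ?_ fun i => ?_
  · change ∀ j : Fin 4, _
    simp [Fin.forall_fin_succ, hx, hy, hz, ht]
  · rcases h i with ⟨h1, h2, h3⟩ | ⟨h1, h2, h3⟩ | ⟨h1, h2, h3⟩ | ⟨h1, h2, h3⟩
    · refine ⟨(0 : Fin 4), ![w i, t i], rfl, ?_⟩
      change ∀ j : Fin 4, _
      simp [Fin.forall_fin_succ, arith', h1, h2, h3]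
    · refine ⟨(1 : Fin 4), ![w i, z i], rfl, ?_⟩
      change ∀ j : Fin 4, _
      simp [Fin.forall_fin_succ, arith', h1, h2, h3]
    · refine ⟨(2 : Fin 4), ![w i, t i], rfl, ?_⟩
      change ∀ j : Fin 4, _
      simp [Fin.forall_fin_succ, arith', h1, h2, h3]
    · refine ⟨(3 : Fin 4), ![w i, t i], rfl, ?_⟩
      change ∀ j : Fin 4, _
      simp [Fin.forall_fin_succ, arith', h1, h2, h3]

theorem mem_of_D {n : ℕ} [NeZero n] (hM : HasClosedRelations C (D n))
    {t : Fin n → ∀ i, Y ⟶ X i} {w : ∀ i, Y ⟶ X i} (ht : ∀ j, r.Mem (t j))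
    (h : ∀ i, ∃ k, ∀ j, j ≠ k → t j i = w i) : r.Mem w := by
  refine hM.mem (t := t) ht fun i => ?_
  obtain ⟨k, hk⟩ := h i
  refine ⟨k, ![w i, t k i], rfl, fun j => ?_⟩
  by_cases hj : k = j
  · subst hj
    simp [D]
  · simp [D, hj, hk j (Ne.symm hj)]

end Membership

/-! ### Derivations between matrices in left exact categories -/

section Implications

variable {C : Type u} [Category.{v} C] [HasFiniteLimits C]

theorem maltsev_of_arith (h : HasClosedRelations C arith) : HasClosedRelations C maltsev := by
  intro X r Y (f : Fin 2 → (Y ⟶ X)) (hf : ∀ j : Fin 3, _)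
  change r.Mem fun _ => f 0
  refine mem_of_arith h (hf 0) (hf 1) (hf 2) ?_
  change ∀ i : Fin 2, _
  simp [Fin.forall_fin_succ, maltsev]

theorem D_three_of_arith (h : HasClosedRelations C arith) : HasClosedRelations C (D 3) := by
  intro X r Y (f : Fin 2 → (Y ⟶ X)) (hf : ∀ j : Fin 3, _)
  change r.Mem fun _ => f 0
  -- This is the majority term `p(x, p(x, y, z), z)` built from a Pixley term `p`; `h1` is the inner
  -- value.
  have h1 : r.Mem ![f 1, f 0, f 1] := by
    refine mem_of_arith h (hf 0) (hf 1) (hf 2) ?_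
    change ∀ i : Fin 3, _
    simp [Fin.forall_fin_succ, D]
  refine mem_of_arith h (hf 0) h1 (hf 2) ?_
  change ∀ i : Fin 3, _
  simp [Fin.forall_fin_succ, D]

theorem arith_of_maltsev_of_D_three (h : HasClosedRelations C maltsev)
    (h' : HasClosedRelations C (D 3)) : HasClosedRelations C arith := by
  intro X r Y (f : Fin 2 → (Y ⟶ X)) (hf : ∀ j : Fin 3, _)
  change r.Mem fun _ => f 0
  -- The rowwise majority of the columns of `A`. Put in place of the middle column, it turns the
  -- last row into the constant `f 0`, leaving a Mal'tsev problem.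
  have h1 : r.Mem ![f 1, f 1, f 0] := by
    refine mem_of_D h' hf ?_
    change ∀ i : Fin 3, _
    simp [Fin.forall_fin_succ, Fin.exists_fin_succ, arith]
  refine mem_of_maltsev h (hf 0) h1 (hf 2) ?_
  change ∀ i : Fin 3, _
  simp [Fin.forall_fin_succ, arith]

theorem D_of_D_three {n : ℕ} [NeZero n] (hn : 2 < n) (h : HasClosedRelations C (D 3)) :
    HasClosedRelations C (D n) := by
  intro X r Y (f : Fin 2 → (Y ⟶ X)) (hf : ∀ j : Fin n, _)
  change r.Mem fun _ => f 0
  -- The first three columns suffice: each row of `D n` has at most one 1 among them.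
  refine mem_of_D h (t := fun j i => f ((D n).entry i (j.castLE hn))) (fun j => hf _) fun i => ?_
  obtain ⟨k, hk⟩ : ∃ k : Fin 3, ∀ j, j ≠ k → i.1 ≠ j.1 := by
    by_cases hi : i.1 < 3
    · exact ⟨⟨i, hi⟩, fun j hj h => hj (Fin.ext h.symm)⟩
    · exact ⟨0, fun j _ => by omega⟩
  refine ⟨k, fun j hj => congrArg f (if_neg fun h => hk j hj ?_)⟩
  rw [h]
  rfl

theorem maltsev_of_arith' (h : HasClosedRelations C arith') : HasClosedRelations C maltsev := by
  intro X r Y (f : Fin 2 → (Y ⟶ X)) (hf : ∀ j : Fin 3, _)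
  change r.Mem fun _ => f 0
  refine mem_of_arith' h (hf 0) (hf 2) (hf 1) (hf 1) ?_
  change ∀ i : Fin 2, _
  simp [Fin.forall_fin_succ, maltsev]

theorem D_four_of_arith' (h : HasClosedRelations C arith') : HasClosedRelations C (D 4) := by
  intro X r Y (f : Fin 2 → (Y ⟶ X)) (hf : ∀ j : Fin 4, _)
  change r.Mem fun _ => f 0
  have h1 : r.Mem ![f 1, f 1, f 0, f 0] := by
    refine mem_of_arith' h (hf 0) (hf 1) (hf 2) (hf 3) ?_
    change ∀ i : Fin 4, _
    simp [Fin.forall_fin_succ, D]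
  refine mem_of_arith' h (hf 0) (hf 1) h1 h1 ?_
  change ∀ i : Fin 4, _
  simp [Fin.forall_fin_succ, D]

theorem arith'_of_maltsev_of_D_four (h : HasClosedRelations C maltsev)
    (h' : HasClosedRelations C (D 4)) : HasClosedRelations C arith' := by
  intro X r Y (f : Fin 2 → (Y ⟶ X)) (hf : ∀ j : Fin 4, _)
  change r.Mem fun _ => f 0
  -- In each row of `A'`, three of the four entries agree; these common values form the middle term
  -- of a Mal'tsev step between the first two columns.
  have h1 : r.Mem ![f 0, f 0, f 1, f 1] := by
    refine mem_of_D h' hf ?_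
    change ∀ i : Fin 4, _
    simp [Fin.forall_fin_succ, Fin.exists_fin_succ, arith']
  refine mem_of_maltsev h (hf 0) h1 (hf 1) ?_
  change ∀ i : Fin 4, _
  simp [Fin.forall_fin_succ, arith']

end Implications

/-! ### Regular categories: near unanimity on zigzags -/

section Regular

variable {C : Type u} [Category.{v} C]

theorem InternalRel.mem_of_strongEpi [HasFiniteLimits C] {p : ℕ} {X : Fin p → C}
    (r : InternalRel X) {Y Y' : C} (e : Y' ⟶ Y) [StrongEpi e] {x : ∀ i, Y ⟶ X i}
    (h : r.Mem fun i => e ≫ x i) : r.Mem x := by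
  obtain ⟨u, hu⟩ := h
  have : Mono (Pi.lift r.proj) := ⟨fun x y hxy => r.jointly_monic x y fun i => by
    simpa using hxy =≫ Pi.π X i⟩
  have sq : CommSq u e (Pi.lift r.proj) (Pi.lift x) :=
    ⟨Pi.hom_ext _ _ fun i => by simp [hu]⟩
  refine ⟨sq.lift, fun i => ?_⟩
  have h := sq.fac_right =≫ Pi.π X i
  rw [Category.assoc, Pi.lift_π, Pi.lift_π] at h
  exact h.symm

theorem exists_joint_equalizer [HasFiniteLimits C] {U X : C} {K : Type} [Finite K]
    (g h : K → (U ⟶ X)) : ∃ (W : C) (ι : W ⟶ U), (∀ k, ι ≫ g k = ι ≫ h k) ∧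
      ∀ (Y : C) (y : Y ⟶ U), (∀ k, y ≫ g k = y ≫ h k) → ∃ l, l ≫ ι = y := by
  refine ⟨equalizer (Pi.lift g) (Pi.lift h), equalizer.ι _ _, fun k => ?_, fun Y y hy => ?_⟩
  · simpa using equalizer.condition (Pi.lift g) (Pi.lift h) =≫ Pi.π _ k
  · exact ⟨equalizer.lift y (Pi.hom_ext _ _ fun k => by simpa using hy k), by simp⟩

/-- In a regular category with `D n`-closed relations, solutions of near unanimity problems in the
image of a family of morphisms lift locally to the domain. -/
theorem exists_local_lift_of_D [Regular C] {n : ℕ} [NeZero n] (hD : HasClosedRelations C (D n))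
    {p : ℕ} {Z : Fin p → C} {W : C} (ρ : ∀ i, W ⟶ Z i) {Y : C} (t : Fin n → (Y ⟶ W))
    (x : ∀ i, Y ⟶ Z i) (h : ∀ i, ∃ k, ∀ j, j ≠ k → t j ≫ ρ i = x i) :
    ∃ (Y' : C) (e : Y' ⟶ Y) (_ : StrongEpi e) (y : Y' ⟶ W), ∀ i, y ≫ ρ i = e ≫ x i := by
  let F := Regular.strongEpiMonoFactorisation (Pi.lift ρ)
  have hF : F.e ≫ F.m = Pi.lift ρ := F.fac
  let r : InternalRel Z :=
    { obj := F.I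
      proj := fun i => F.m ≫ Pi.π Z i
      jointly_monic := fun Y x y hxy => by
        rw [← cancel_mono F.m]
        exact Pi.hom_ext _ _ fun i => by simpa using hxy i }
  have hr : ∀ i, F.e ≫ r.proj i = ρ i := fun i => by
    rw [reassoc_of% hF, Pi.lift_π]
  obtain ⟨v, hv⟩ : r.Mem x :=
    mem_of_D hD (t := fun j i => t j ≫ ρ i) (fun j => ⟨t j ≫ F.e, fun i => by simp [hr]⟩) h
  -- The solution `v` lies only in the image; pulling back along the strong epi `F.e` lifts it to
  -- `W` on a cover of `Y`.
  refine ⟨pullback v F.e, pullback.fst _ _, inferInstance, pullback.snd _ _, fun i => ?_⟩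
  rw [hv, ← hr, ← pullback.condition_assoc]

/-- Let `W` classify zigzags in `r`: elements `c i` sharing their third coordinate, where `d i` has
the second coordinate of `c i` and the first of `c (i + 1)`. With the columns `t₀`, `t₁`, `t₂` of
`A` one forms `n` zigzags, switching from `t₀` to `t₂` at different places with `t₁` as the link.
Each required value `f 0` fails in at most one of them, so `D n` gives, locally, a zigzag with all
these values. -/
theorem arith_of_maltsev_of_D [Regular C] {n : ℕ} [NeZero n] (hn : 2 < n)
    (hM : HasClosedRelations C maltsev) (hD : HasClosedRelations C (D n)) :
    HasClosedRelations C arith := by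
  intro X r Y (f : Fin 2 → (Y ⟶ X)) (hf : ∀ j : Fin 3, _)
  change r.Mem fun _ => f 0
  change InternalRel fun _ : Fin 3 => X at r
  obtain ⟨t₀, h₀⟩ := hf 0
  replace h₀ : t₀ ≫ r.proj 0 = f 0 ∧ t₀ ≫ r.proj 1 = f 1 ∧ t₀ ≫ r.proj 2 = f 0 :=
    ⟨(h₀ (0 : Fin 3)).symm, (h₀ (1 : Fin 3)).symm, (h₀ (2 : Fin 3)).symm⟩
  obtain ⟨t₁, h₁⟩ := hf 1
  replace h₁ : t₁ ≫ r.proj 0 = f 1 ∧ t₁ ≫ r.proj 1 = f 1 ∧ t₁ ≫ r.proj 2 = f 1 :=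
    ⟨(h₁ (0 : Fin 3)).symm, (h₁ (1 : Fin 3)).symm, (h₁ (2 : Fin 3)).symm⟩
  obtain ⟨t₂, h₂⟩ := hf 2
  replace h₂ : t₂ ≫ r.proj 0 = f 1 ∧ t₂ ≫ r.proj 1 = f 0 ∧ t₂ ≫ r.proj 2 = f 0 :=
    ⟨(h₂ (0 : Fin 3)).symm, (h₂ (1 : Fin 3)).symm, (h₂ (2 : Fin 3)).symm⟩
  obtain ⟨m, rfl⟩ : ∃ m, n = m + 3 := ⟨n - 3, by omega⟩
  let U : C := ∏ᶜ fun _ : Fin (m + 2) ⊕ Fin (m + 1) => r.obj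
  let c : Fin (m + 2) → (U ⟶ r.obj) := fun i => Pi.π _ (Sum.inl i)
  let d : Fin (m + 1) → (U ⟶ r.obj) := fun i => Pi.π _ (Sum.inr i)
  obtain ⟨W, ι, hι, hW⟩ := exists_joint_equalizer
    (Sum.elim (fun i => c i ≫ r.proj 2)
      (Sum.elim (fun i => d i ≫ r.proj 0) (fun i => d i ≫ r.proj 1)))
    (Sum.elim (fun _ => c 0 ≫ r.proj 2)
      (Sum.elim (fun i => c i.succ ≫ r.proj 0) (fun i => c i.castSucc ≫ r.proj 1)))
  simp only [Sum.forall, Sum.elim_inl, Sum.elim_inr] at hι hW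
  obtain ⟨hι₂, hι₀, hι₁⟩ := hι
  have ht : ∀ j : Fin (m + 3), ∃ t : Y ⟶ W,
      (∀ i, t ≫ ι ≫ c i = if j.1 + i.1 < m + 2 then t₀ else t₂) ∧
      (∀ i, t ≫ ι ≫ d i = if j.1 + i.1 < m + 1 then t₀ else
        if j.1 + i.1 = m + 1 then t₁ else t₂) := by
    intro j
    let y : Y ⟶ U := Pi.lift (Sum.elim (fun i => if j.1 + i.1 < m + 2 then t₀ else t₂)
      (fun i => if j.1 + i.1 < m + 1 then t₀ else if j.1 + i.1 = m + 1 then t₁ else t₂))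
    have hc : ∀ i, y ≫ c i = if j.1 + i.1 < m + 2 then t₀ else t₂ := fun i => by simp [y, c]
    have hd : ∀ i, y ≫ d i = if j.1 + i.1 < m + 1 then t₀ else
        if j.1 + i.1 = m + 1 then t₁ else t₂ := fun i => by simp [y, d]
    have hyW : ∃ t, t ≫ ι = y := by
      refine hW Y y ⟨fun i => ?_, fun i => ?_, fun i => ?_⟩
      · rw [reassoc_of% hc, reassoc_of% hc]
        split_ifs <;> simp [h₀, h₂]
      · rw [reassoc_of% hc, reassoc_of% hd, Fin.val_succ]
        split_ifs <;> first | omega | simp [h₀, h₁, h₂]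
      · rw [reassoc_of% hc, reassoc_of% hd, Fin.val_castSucc]
        split_ifs <;> first | omega | simp [h₀, h₁, h₂]
    obtain ⟨t, ht⟩ := hyW
    exact ⟨t, fun i => by rw [← hc, ← ht, Category.assoc],
      fun i => by rw [← hd, ← ht, Category.assoc]⟩
  choose t htc htd using ht
  obtain ⟨Y', e, he, y, hy⟩ := exists_local_lift_of_D hD (Z := fun _ => X)
    (Fin.cons (ι ≫ c 0 ≫ r.proj 0) (Fin.cons (ι ≫ c (Fin.last _) ≫ r.proj 1)
      (Fin.cons (ι ≫ c 0 ≫ r.proj 2) (fun i => ι ≫ d i ≫ r.proj 2)))) t (fun _ => f 0) (by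
    -- The end conditions fail only at the extreme indices `j = m + 2` and `j = 0`; the condition on
    -- `d i` fails only where `d i` is `t₁`, at `j = m + 1 - i`.
    refine Fin.cases ⟨Fin.last _, fun j hj => ?_⟩ (Fin.cases ⟨0, fun j hj => ?_⟩
      (Fin.cases ⟨0, fun j _ => ?_⟩ fun i => ⟨⟨m + 1 - i, by omega⟩, fun j hj => ?_⟩))
    · simp only [Fin.cons_zero]
      have hj' : j.1 ≠ m + 2 := fun h => hj (Fin.ext h)
      rw [reassoc_of% htc, Fin.val_zero, if_pos (by omega), h₀.1]
    · simp only [Fin.cons_succ, Fin.cons_zero]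
      have hj' : j.1 ≠ 0 := fun h => hj (Fin.ext h)
      rw [reassoc_of% htc, Fin.val_last, if_neg (by omega), h₂.2.1]
    · simp only [Fin.cons_succ, Fin.cons_zero]
      rw [reassoc_of% htc]
      split_ifs <;> simp [h₀, h₂]
    · simp only [Fin.cons_succ]
      have hj' : j.1 + i.1 ≠ m + 1 := fun h => hj (Fin.ext (by simp; omega))
      rw [reassoc_of% htd, if_neg hj']
      split_ifs <;> simp [h₀, h₂])
  have hy₀ : y ≫ ι ≫ c 0 ≫ r.proj 0 = e ≫ f 0 := hy 0
  have hy₁ : y ≫ ι ≫ c (Fin.last _) ≫ r.proj 1 = e ≫ f 0 := hy (Fin.succ 0)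
  have hy₂ : y ≫ ι ≫ c 0 ≫ r.proj 2 = e ≫ f 0 := hy (Fin.succ (Fin.succ 0))
  have hy₃ : ∀ i, y ≫ ι ≫ d i ≫ r.proj 2 = e ≫ f 0 := fun i => hy i.succ.succ.succ
  refine r.mem_of_strongEpi e ?_
  -- Mal'tsev applied to the previous triple, `d i` and `c (i + 1)` carries the first coordinate `f
  -- 0` along the zigzag; at the last `c` the second coordinate is `f 0` too.
  have key : ∀ i : Fin (m + 2), r.Mem ![e ≫ f 0, y ≫ ι ≫ c i ≫ r.proj 1, e ≫ f 0] := by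
    intro i
    induction i using Fin.induction with
    | zero => exact ⟨y ≫ ι ≫ c 0, by simp [Fin.forall_fin_succ, hy₀, hy₂]⟩
    | succ i ih =>
      refine mem_of_maltsev hM ih (y := fun k => (y ≫ ι ≫ d i) ≫ r.proj k) ⟨_, fun _ => rfl⟩
        (z := fun k => (y ≫ ι ≫ c i.succ) ≫ r.proj k) ⟨_, fun _ => rfl⟩ ?_
      simp [Fin.forall_fin_succ, hy₃, hι₀, hι₁, hι₂, hy₂]
  obtain ⟨u, hu⟩ := key (Fin.last _)
  rw [hy₁] at hu
  exact ⟨u, fun i => by rw [← hu]; fin_cases i <;> rfl⟩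

end Regular

/-! ### Sharp relations and injective objects -/

section RelCat

variable {n : ℕ}

/-- The set `T` equipped with the full relation. -/
def RelCat.codiscrete (n : ℕ) (T : Type w) : RelCat.{w} n where
  carrier := T
  rel := Set.univ

/-- Every function into a set with the full relation is a morphism. -/
def RelCat.toCodiscrete (W : RelCat.{w} n) {T : Type w} (f : W.carrier → T) :
    W ⟶ RelCat.codiscrete n T :=
  RelCat.Hom.mk f fun _ _ => Set.mem_univ _

theorem RelCat.congr_toFun {X Y : RelCat.{w} n} {f g : X ⟶ Y} (h : f = g) (x : X.carrier) :
    RelCat.Hom.toFun f x = RelCat.Hom.toFun g x := by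
  rw [h]

theorem RelCat.hom_ext {X Y : RelCat.{w} n} {f g : X ⟶ Y}
    (h : ∀ x, RelCat.Hom.toFun f x = RelCat.Hom.toFun g x) : f = g :=
  RelCat.Hom.ext (funext h)

/-- A family of morphisms of relations which is jointly epic with respect to full relations is
jointly surjective. -/
theorem RelCat.jointly_surjective {ι : Type*} {Z W : RelCat.{w} n} (e : ι → (Z ⟶ W))
    (he : ∀ x y : W ⟶ RelCat.codiscrete n (ULift.{w} Prop), (∀ i, e i ≫ x = e i ≫ y) → x = y)
    (a : W.carrier) : ∃ i z, RelCat.Hom.toFun (e i) z = a := by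
  -- The joint image and the whole set have characteristic functions that agree on the image.
  have h := he (W.toCodiscrete fun b => ⟨∃ i z, RelCat.Hom.toFun (e i) z = b⟩)
    (W.toCodiscrete fun _ => ⟨True⟩) fun i => RelCat.hom_ext fun z =>
      congrArg ULift.up (eq_true ⟨i, z, rfl⟩)
  exact of_eq_true (congrArg ULift.down (RelCat.congr_toFun h a))

theorem RelCat.jointly_epic {ι : Type*} {Z W X : RelCat.{w} n} (e : ι → (Z ⟶ W))
    (he : ∀ a, ∃ i z, RelCat.Hom.toFun (e i) z = a) {x y : W ⟶ X}
    (h : ∀ i, e i ≫ x = e i ≫ y) : x = y := by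
  refine RelCat.hom_ext fun a => ?_
  obtain ⟨i, z, rfl⟩ := he a
  exact RelCat.congr_toFun (h i) z

/-- Row-wise interpretations of any two rows of `N` which agree on the left columns agree on the
right column; equivalently, equality relations are sharp. -/
def EqualitySharp (N : IntMatrix) : Prop :=
  ∀ (i i' : Fin N.n) ⦃T : Type w⦄ (a b : Fin N.k → T),
    (∀ j, a (N.entry i j) = b (N.entry i' j)) → a 0 = b 0

theorem equalitySharp_maltsev : EqualitySharp.{w} maltsev := by
  intro (i : Fin 2) (i' : Fin 2) T (a : Fin 2 → T) (b : Fin 2 → T) (h : ∀ j : Fin 3, _)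
  have h0 := h 0
  have h1 := h 1
  have h2 := h 2
  change a 0 = b 0
  fin_cases i <;> fin_cases i' <;> simp_all [maltsev]

theorem equalitySharp_D {m : ℕ} [NeZero m] (hm : 2 < m) : EqualitySharp.{w} (D m) := by
  intro (i : Fin m) (i' : Fin m) T a b (h : ∀ j : Fin m, _)
  obtain ⟨j, hj⟩ : ∃ j, j ∉ ({i, i'} : Finset (Fin m)) := by
    by_contra! hc
    have := Finset.card_le_card (fun j _ => hc j : Finset.univ ⊆ ({i, i'} : Finset (Fin m)))
    have := Finset.card_le_two (a := i) (b := i')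
    simp at *
    omega
  simp only [Finset.mem_insert, Finset.mem_singleton, not_or] at hj
  have h' := h j
  simp only [D, if_neg (Ne.symm hj.1), if_neg (Ne.symm hj.2)] at h'
  exact h'

/-- Choose a preimage `z a` of each point `a` and let `v` send `a` to `f 0 (z a)`. Sharpness makes
`v` preserve the relation; `EqualitySharp` makes it independent of the chosen preimages. -/
theorem exists_hom_of_isSharp {N : IntMatrix} (hN : EqualitySharp.{w} N) {Z W X : RelCat.{w} n}
    (hX : IsSharp X.rel N) (e : Fin N.n → (Z ⟶ W))
    (he : ∀ a, ∃ i z, RelCat.Hom.toFun (e i) z = a) (f : Fin N.k → (Z ⟶ X))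
    (u : Fin N.m → (W ⟶ X)) (hu : ∀ i j, f (N.entry i j) = e i ≫ u j) :
    ∃ v : W ⟶ X, ∀ i, f 0 = e i ≫ v := by
  choose g z hgz using he
  have hu' : ∀ a j, RelCat.Hom.toFun (f (N.entry (g a) j)) (z a) = RelCat.Hom.toFun (u j) a := by
    intro a j
    conv_rhs => rw [← hgz a]
    exact RelCat.congr_toFun (hu (g a) j) (z a)
  let v : W ⟶ X := RelCat.Hom.mk (fun a => RelCat.Hom.toFun (f 0) (z a)) fun w hw => by
    refine hX (fun i => N.entry (g (w i))) (fun i => ⟨_, rfl⟩)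
      (fun i b => RelCat.Hom.toFun (f b) (z (w i))) fun j => ?_
    simp only [hu']
    exact RelCat.Hom.map_rel (u j) w hw
  refine ⟨v, fun i => RelCat.hom_ext fun z' => ?_⟩
  refine hN i (g (RelCat.Hom.toFun (e i) z')) (fun b => RelCat.Hom.toFun (f b) z')
    (fun b => RelCat.Hom.toFun (f b) (z (RelCat.Hom.toFun (e i) z'))) fun j => ?_
  rw [hu']
  exact RelCat.congr_toFun (hu i j) z'

theorem isInjective_of_isSharp {N : IntMatrix} (hN : EqualitySharp.{w} N) {X : RelCat.{w} n}
    (hX : IsSharp X.rel N) : IsInjective {N} X := by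
  rintro _ rfl Z r f hf
  choose u hu using hf
  obtain ⟨v, hv⟩ := exists_hom_of_isSharp hN hX (fun i => (r.proj i).unop)
    (RelCat.jointly_surjective _ fun x y h => Quiver.Hom.op_inj (r.jointly_monic x.op y.op
      fun i => Quiver.Hom.unop_inj (h i)))
    (fun b => (f b).unop) (fun j => (u j).unop) (fun i j => congrArg Quiver.Hom.unop (hu j i))
  exact ⟨v.op, fun i => Quiver.Hom.unop_inj (hv i)⟩

/-- A generic instance: `W` carries a single tuple, whose place `i` lies in the copy of `Z` indexed
by the row `g i`. Maps out of `W` respecting it are exactly tuples of `X.rel`. -/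
theorem isSharp_of_isInjective {N : IntMatrix} {X : RelCat.{w} n} (hX : IsInjective {N} X) :
    IsSharp X.rel N := by
  intro M' hM' f hf
  choose g hg using hM'
  let Z : RelCat.{w} n := ⟨ULift.{w} (Fin n), ∅⟩
  let W : RelCat.{w} n := ⟨ULift.{w} (Fin N.n × Fin n), {fun i => ⟨(g i, i)⟩}⟩
  let e : Fin N.n → (Z ⟶ W) := fun a => RelCat.Hom.mk (fun i => ⟨(a, i.down)⟩) fun _ hx => hx.elim
  let r : InternalRel (fun _ : Fin N.n => Opposite.op Z) :=
    { obj := Opposite.op W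
      proj := fun a => (e a).op
      jointly_monic := fun Y x y h => Quiver.Hom.unop_inj (RelCat.jointly_epic e
        (fun a => ⟨a.down.1, ⟨a.down.2⟩, rfl⟩) fun i => congrArg Quiver.Hom.unop (h i)) }
  let φ : Fin N.k → (Z ⟶ X) := fun b => RelCat.Hom.mk (fun i => f i.down b) fun _ hx => hx.elim
  let u : Fin N.m → (W ⟶ X) := fun j =>
    RelCat.Hom.mk (fun a => f a.down.2 (N.entry a.down.1 j)) fun x hx => by
      obtain rfl : x = _ := hx
      simpa only [hg] using hf j
  obtain ⟨v, hv⟩ := hX N rfl (Opposite.op Z) r (fun b => (φ b).op) fun j => ⟨(u j).op, fun i => rfl⟩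
  have hv' : ∀ i, f i 0 = RelCat.Hom.toFun v.unop ⟨(g i, i)⟩ := fun i =>
    RelCat.congr_toFun (congrArg Quiver.Hom.unop (hv (g i))) ⟨i⟩
  simp only [hv']
  exact RelCat.Hom.map_rel v.unop _ rfl

theorem isInjective_iff_isSharp {N : IntMatrix} (hN : EqualitySharp.{w} N) (X : RelCat.{w} n) :
    IsInjective {N} X ↔ IsSharp X.rel N :=
  ⟨isSharp_of_isInjective, isInjective_of_isSharp hN⟩

/-- If all objects of `Inj_{M} Rel_n` are `N`-sharp, then its dual has `N`-closed relations. -/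
theorem hasClosedRelations_op_inj {M N : IntMatrix} (hM : EqualitySharp.{w} M)
    (hN : EqualitySharp.{w} N)
    (h : ∀ X : RelCat.{w} n, IsSharp X.rel M → IsSharp X.rel N) :
    HasClosedRelations (Inj (RelCat.{w} n) {M})ᵒᵖ N := by
  intro Z r Y f hf
  choose u hu using hf
  -- The full relation on truth values is itself injective, so joint epimorphy in the subcategory
  -- still forces joint surjectivity.
  have hcod : IsInjective {M} (RelCat.codiscrete n (ULift.{w} Prop)) :=
    isInjective_of_isSharp hM fun _ _ _ _ => Set.mem_univ _
  obtain ⟨v, hv⟩ := exists_hom_of_isSharp hN (h _ (isSharp_of_isInjective Y.unop.property))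
    (fun i => (r.proj i).unop.hom)
    (RelCat.jointly_surjective _ fun x y h => by
      have := r.jointly_monic (Y := Opposite.op ⟨_, hcod⟩) (Quiver.Hom.op (ObjectProperty.homMk x))
        (Quiver.Hom.op (ObjectProperty.homMk y))
        fun i => Quiver.Hom.unop_inj (ObjectProperty.hom_ext _ (h i))
      exact congrArg (fun q => q.unop.hom) this)
    (fun b => (f b).unop.hom) (fun j => (u j).unop.hom)
    (fun i j => congrArg (fun q => q.unop.hom) (hu j i))
  exact ⟨Quiver.Hom.op (ObjectProperty.homMk v),
    fun i => Quiver.Hom.unop_inj (ObjectProperty.hom_ext _ (hv i))⟩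

/-- Every `n`-ary relation is `D m`-sharp for `m > n`. -/
theorem isSharp_D {m : ℕ} [NeZero m] (hm : n < m) {X : Type w} (R : Set (Fin n → X)) :
    IsSharp R (D m) := by
  intro M' hM' f hf
  choose g hg using hM'
  -- By pigeonhole some column `k` avoids the 1 of every row used, so it already equals the right
  -- column.
  obtain ⟨k, hk⟩ : ∃ k, k ∉ Set.range g := by
    by_contra! hc
    have : m ≤ n := by simpa using Fintype.card_le_of_surjective (β := Fin m) g hc
    omega
  have h := hf k
  have hM'k : ∀ i, M' i k = (0 : Fin 2) := fun i => by
    rw [hg]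
    exact if_neg fun h => hk ⟨i, h⟩
  simp only [hM'k] at h
  exact h

end RelCat

/-! ### Finite colimits of injective objects -/

section Colimits

variable {n : ℕ}

/-- The smallest `N`-sharp relation containing a given relation. -/
def sharpClosure {T : Type w} (R : Set (Fin n → T)) (N : IntMatrix) : Set (Fin n → T) :=
  ⋂₀ {S | IsSharp S N ∧ R ⊆ S}

theorem isSharp_sharpClosure {T : Type w} (R : Set (Fin n → T)) (N : IntMatrix) :
    IsSharp (sharpClosure R N) N :=
  fun M' hM' f hf S hS => hS.1 M' hM' f fun j => hf j S hS

theorem subset_sharpClosure {T : Type w} (R : Set (Fin n → T)) (N : IntMatrix) :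
    R ⊆ sharpClosure R N :=
  fun _ hx _ hS => hS.2 hx

theorem sharpClosure_subset_preimage {T T' : Type w} {R : Set (Fin n → T)} {N : IntMatrix}
    {S : Set (Fin n → T')} (hS : IsSharp S N) (φ : T → T')
    (h : ∀ x ∈ R, (fun i => φ (x i)) ∈ S) :
    ∀ x ∈ sharpClosure R N, (fun i => φ (x i)) ∈ S :=
  fun _ hx => hx {y | (fun i => φ (y i)) ∈ S}
    ⟨fun M' hM' f hf => hS M' hM' (fun i a => φ (f i a)) hf, h⟩

/-- The functor sending an injective object to its underlying set. -/
def Inj.forget (n : ℕ) (N : IntMatrix) : Inj (RelCat.{w} n) {N} ⥤ Type w where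
  obj X := X.obj.carrier
  map f := TypeCat.ofHom (RelCat.Hom.toFun f.hom)

/-- The morphism of `Inj_{N} Rel_n` given by a relation-preserving function. -/
def Inj.homOfFun {N : IntMatrix} {X Y : Inj (RelCat.{w} n) {N}}
    (φ : X.obj.carrier → Y.obj.carrier) (h : ∀ x ∈ X.obj.rel, (fun i => φ (x i)) ∈ Y.obj.rel) :
    X ⟶ Y :=
  ObjectProperty.homMk (RelCat.Hom.mk φ h)

theorem Inj.hom_ext {N : IntMatrix} {X Y : Inj (RelCat.{w} n) {N}} {f g : X ⟶ Y}
    (h : (Inj.forget n N).map f = (Inj.forget n N).map g) : f = g :=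
  ObjectProperty.hom_ext _ (RelCat.hom_ext fun x => ConcreteCategory.congr_hom h x)

/-- Colimits are those of sets, with the sharp closure of the union of the image relations;
preimages of sharp relations are sharp, so induced maps preserve the closure. -/
theorem hasFiniteColimits_inj {N : IntMatrix} (hN : EqualitySharp.{w} N) :
    HasFiniteColimits (Inj (RelCat.{w} n) {N}) := by
  refine ⟨fun J _ _ => ⟨fun F => ?_⟩⟩
  let G : J ⥤ Type w := F ⋙ Inj.forget n N
  let R : Set (Fin n → colimit G) :=
    {y | ∃ j, ∃ x ∈ (F.obj j).obj.rel, y = fun i => colimit.ι G j (x i)}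
  let L : Inj (RelCat.{w} n) {N} :=
    ⟨⟨colimit G, sharpClosure R N⟩, isInjective_of_isSharp hN (isSharp_sharpClosure R N)⟩
  let inc : ∀ j, F.obj j ⟶ L := fun j => Inj.homOfFun (colimit.ι G j)
    fun x hx => subset_sharpClosure R N ⟨j, x, hx, rfl⟩
  let c : Cocone F :=
    { pt := L
      ι := { app := inc
             naturality := fun j j' φ => Inj.hom_ext
              ((colimit.w G φ).trans (Category.comp_id _).symm) } }
  let desc : ∀ s : Cocone F, L ⟶ s.pt := fun s =>
    Inj.homOfFun (colimit.desc G ((Inj.forget n N).mapCocone s))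
      (sharpClosure_subset_preimage (isSharp_of_isInjective s.pt.property) _ (by
        rintro _ ⟨j, x, hx, rfl⟩
        have h := RelCat.Hom.map_rel (s.ι.app j).hom x hx
        have hd : ∀ a, (colimit.desc G ((Inj.forget n N).mapCocone s)) (colimit.ι G j a) =
            RelCat.Hom.toFun (s.ι.app j).hom a :=
          ConcreteCategory.congr_hom (colimit.ι_desc ((Inj.forget n N).mapCocone s) j)
        exact (congrArg (· ∈ s.pt.obj.rel) (funext fun i => hd (x i))).mpr h))
  exact HasColimit.mk
    { cocone := c
      isColimit :=
        { desc := desc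
          fac := fun s j => Inj.hom_ext (colimit.ι_desc ((Inj.forget n N).mapCocone s) j)
          uniq := fun s m hm => Inj.hom_ext (colimit.hom_ext fun j =>
            (congrArg (Inj.forget n N).map (hm j)).trans
              (colimit.ι_desc ((Inj.forget n N).mapCocone s) j).symm) } }

end Colimits

/-! ### The separating example -/

section Example

/-- The ternary relation on the two-element set consisting of the triples with exactly one
entry equal to `true`. -/
def exactlyOne : RelCat.{w} 3 where
  carrier := ULift.{w} Bool
  rel := {x | ∃ k, ∀ i, (x i).down = true ↔ i = k}

theorem isSharp_exactlyOne : IsSharp exactlyOne.{w}.rel maltsev := by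
  intro (M' : Fin 3 → Fin 3 → Fin 2) (hM' : ∀ i, ∃ i' : Fin 2, _)
    (f : Fin 3 → Fin 2 → ULift Bool) (hf : ∀ j : Fin 3, _)
  choose g hg using hM'
  have key : ∀ (g : Fin 3 → Fin 2) (b : Fin 3 → Fin 2 → Bool),
      (∀ j : Fin 3, ∃ k, ∀ i, b i (maltsev.entry (g i) j) = true ↔ i = k) →
      ∃ k, ∀ i, b i 0 = true ↔ i = k := by
    decide
  refine key g (fun i a => (f i a).down) fun j => ?_
  obtain rfl : M' = fun i => maltsev.entry (g i) := funext hg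
  exact hf j

theorem not_hasClosedRelations_D_three {M : IntMatrix} (hM : EqualitySharp.{w} M)
    (hX : IsSharp exactlyOne.{w}.rel M) (hW : IsSharp (X := ULift.{w} (Fin 3)) {ULift.up} M)
    (hZ : IsSharp (∅ : Set (Fin 3 → PUnit.{w + 1})) M) :
    ¬ HasClosedRelations (Inj (RelCat.{w} 3) {M})ᵒᵖ (D 3) := by
  intro h
  let X : Inj (RelCat.{w} 3) {M} := ⟨exactlyOne, isInjective_of_isSharp hM hX⟩
  let W : Inj (RelCat.{w} 3) {M} := ⟨⟨_, _⟩, isInjective_of_isSharp hM hW⟩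
  let Z : Inj (RelCat.{w} 3) {M} := ⟨⟨_, _⟩, isInjective_of_isSharp hM hZ⟩
  let e : Fin 3 → (Z ⟶ W) := fun i => Inj.homOfFun (fun _ => ⟨i⟩) fun _ hx => hx.elim
  let r : InternalRel (fun _ : Fin 3 => Opposite.op Z) :=
    { obj := Opposite.op W
      proj := fun i => (e i).op
      jointly_monic := fun Y x y hxy => Quiver.Hom.unop_inj (ObjectProperty.hom_ext _
        (RelCat.jointly_epic (fun i => (e i).hom) (fun a => ⟨a.down, ⟨⟩, rfl⟩)
          fun i => congrArg (fun q => q.unop.hom) (hxy i))) }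
  let f : Fin 2 → (Z ⟶ X) := fun b => Inj.homOfFun (fun _ => ⟨b == 1⟩) fun _ hx => hx.elim
  -- The columns of `D 3` are the three triples of `exactlyOne`; a solution `v` would make the
  -- constant `false` triple a member.
  let u : Fin 3 → (W ⟶ X) := fun j => Inj.homOfFun (fun a => ⟨a.down == j⟩) fun x hx => by
    obtain rfl : x = ULift.up := hx
    exact ⟨j, fun i => by simp⟩
  have hD : ∀ i j : Fin 3, (((D 3).entry i j : Fin 2) == 1) = (i == j) := by decide
  obtain ⟨v, hv⟩ := h (Opposite.op Z) r (Opposite.op X) (fun b => (f b).op) fun j =>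
    ⟨(u j).op, fun i => Quiver.Hom.unop_inj (ObjectProperty.hom_ext _
      (RelCat.hom_ext fun _ => congrArg ULift.up (hD i j)))⟩
  obtain ⟨k, hk⟩ := RelCat.Hom.map_rel v.unop.hom ULift.up rfl
  have h1 := RelCat.congr_toFun (congrArg (fun q => q.unop.hom) (hv k)) PUnit.unit
  have h2 : (RelCat.Hom.toFun v.unop.hom ⟨k⟩ : ULift Bool).down = true := (hk k).2 rfl
  have h3 : (⟨false⟩ : ULift Bool) = RelCat.Hom.toFun v.unop.hom ⟨k⟩ := h1
  rw [← h3] at h2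
  exact Bool.false_ne_true h2

theorem isSharp_maltsev_singleton {T : Type w} (x : Fin 3 → T) :
    IsSharp ({x} : Set (Fin 3 → T)) maltsev := by
  intro (M' : Fin 3 → Fin 3 → Fin 2) (hM' : ∀ i, ∃ i' : Fin 2, _) (f : Fin 3 → Fin 2 → T)
    (hf : ∀ j : Fin 3, _)
  refine funext fun i => ?_
  obtain ⟨a, ha⟩ := hM' i
  have h0 : ∀ a : Fin 2, ∃ j : Fin 3, maltsev.entry a j = 0 :=
    fun a => ⟨![0, 2] a, by fin_cases a <;> rfl⟩
  obtain ⟨j, hj⟩ := h0 a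
  rw [← congrFun (hf j) i, ha, hj]

theorem isSharp_maltsev_empty {T : Type w} : IsSharp (∅ : Set (Fin 3 → T)) maltsev :=
  fun _ _ _ hf => (hf (0 : Fin 3)).elim

end Example

/-! ### Assembly of the statements about classes -/

theorem mem_mclex_singleton {C : Cat.{v, u}} {M : IntMatrix} :
    C ∈ mclex.{v, u} {M} ↔ HasFiniteLimits C ∧ HasClosedRelations C M := by
  simp [mclex]

theorem mclex_maltsev_inter_D_three :
    mclex.{v, u} {maltsev} ∩ mclex.{v, u} {D 3} = mclex.{v, u} {arith} := by
  ext C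
  simp only [Set.mem_inter_iff, mem_mclex_singleton]
  constructor
  · rintro ⟨⟨_, h⟩, _, h'⟩
    exact ⟨‹_›, arith_of_maltsev_of_D_three h h'⟩
  · rintro ⟨_, h⟩
    exact ⟨⟨‹_›, maltsev_of_arith h⟩, ‹_›, D_three_of_arith h⟩

theorem mclex_arith' :
    mclex.{v, u} {arith'} = mclex.{v, u} {maltsev} ∩ mclex.{v, u} {D 4} := by
  ext C
  simp only [Set.mem_inter_iff, mem_mclex_singleton]
  constructor
  · rintro ⟨_, h⟩
    exact ⟨⟨‹_›, maltsev_of_arith' h⟩, ‹_›, D_four_of_arith' h⟩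
  · rintro ⟨⟨_, h⟩, _, h'⟩
    exact ⟨‹_›, arith'_of_maltsev_of_D_four h h'⟩

theorem mclex_arith_subset {n : ℕ} [NeZero n] (hn : 2 < n) :
    mclex.{v, u} {arith} ⊆ mclex.{v, u} {maltsev} ∩ mclex.{v, u} {D n} := by
  intro C
  simp only [Set.mem_inter_iff, mem_mclex_singleton]
  rintro ⟨_, h⟩
  exact ⟨⟨‹_›, maltsev_of_arith h⟩, ‹_›, D_of_D_three hn (D_three_of_arith h)⟩

theorem op_inj_mem :
    Cat.of (Inj (RelCat.{w} 3) {maltsev})ᵒᵖ ∈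
      mclex.{w, w + 1} {maltsev} ∩ mclex.{w, w + 1} {D 4} := by
  have := hasFiniteColimits_inj.{w} (n := 3) equalitySharp_maltsev
  have hlim : HasFiniteLimits (Inj (RelCat.{w} 3) {maltsev})ᵒᵖ := inferInstance
  rw [Set.mem_inter_iff, mem_mclex_singleton, mem_mclex_singleton]
  exact ⟨⟨hlim, hasClosedRelations_op_inj equalitySharp_maltsev equalitySharp_maltsev
      fun _ h => h⟩, hlim, hasClosedRelations_op_inj equalitySharp_maltsev
      (equalitySharp_D (by norm_num)) fun X _ => isSharp_D (by norm_num) X.rel⟩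

theorem op_inj_not_mem_D_three :
    Cat.of (Inj (RelCat.{w} 3) {maltsev})ᵒᵖ ∉ mclex.{w, w + 1} {D 3} := fun h =>
  not_hasClosedRelations_D_three equalitySharp_maltsev isSharp_exactlyOne
    (isSharp_maltsev_singleton _) isSharp_maltsev_empty (mem_mclex_singleton.1 h).2

theorem op_inj_not_mem_arith :
    Cat.of (Inj (RelCat.{w} 3) {maltsev})ᵒᵖ ∉ mclex.{w, w + 1} {arith} := fun h =>
  op_inj_not_mem_D_three (mclex_maltsev_inter_D_three.ge h).2

end MatrixClass

open MatrixClass in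
theorem mainTheorem10 :
    -- Mal'tsev and majority is the same as arithmetical, for left exact categories
    mclex.{v, u} {maltsev} ∩ mclex.{v, u} {D 3} = mclex.{v, u} {arith} ∧
    -- Mal'tsev and `D 4` is given by the single matrix `A'`
    mclex.{v, u} {arith'} = mclex.{v, u} {maltsev} ∩ mclex.{v, u} {D 4} ∧
    -- the arithmetical matrix class is contained, and strictly so, in Mal'tsev and `D 4`
    mclex.{v, u} {arith} ⊆ mclex.{v, u} {maltsev} ∩ mclex.{v, u} {D 4} ∧
    mclex.{w, w + 1} {arith} ⊂ mclex.{w, w + 1} {maltsev} ∩ mclex.{w, w + 1} {D 4} ∧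
    -- the Mal'tsev-injective objects of `Rel_3` are the Mal'tsev-sharp ternary relations
    (∀ X : RelCat.{w} 3, IsInjective {maltsev} X ↔ IsSharp X.rel maltsev) ∧
    -- the dual of the category of these separates the two classes, and is not majority
    Cat.of (Inj (RelCat.{w} 3) {maltsev})ᵒᵖ ∈
      mclex.{w, w + 1} {maltsev} ∩ mclex.{w, w + 1} {D 4} ∧
    Cat.of (Inj (RelCat.{w} 3) {maltsev})ᵒᵖ ∉ mclex.{w, w + 1} {D 3} ∧
    Cat.of (Inj (RelCat.{w} 3) {maltsev})ᵒᵖ ∉ mclex.{w, w + 1} {arith} ∧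
    -- for regular categories, Mal'tsev and `D n` is the same as arithmetical for all `n > 2`
    (∀ (n : ℕ) [NeZero n], 2 < n → ∀ (C : Type u) [Category.{v} C] [Regular C],
      (Cat.of C ∈ mclex.{v, u} {maltsev} ∩ mclex.{v, u} {D n} ↔
        Cat.of C ∈ mclex.{v, u} {arith})) := by
  refine ⟨mclex_maltsev_inter_D_three, mclex_arith', mclex_arith_subset (by norm_num),
    ⟨mclex_arith_subset (by norm_num), fun h => op_inj_not_mem_arith (h op_inj_mem)⟩,
    isInjective_iff_isSharp equalitySharp_maltsev, op_inj_mem, op_inj_not_mem_D_three,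
    op_inj_not_mem_arith, fun n _ hn C _ _ => ⟨fun h => ?_, fun h => mclex_arith_subset hn h⟩⟩
  obtain ⟨h₁, h₂⟩ := h
  rw [mem_mclex_singleton] at h₁ h₂ ⊢
  exact ⟨h₁.1, arith_of_maltsev_of_D (C := C) hn h₁.2 h₂.2⟩
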